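/- Let $\Gamma_0\subset\mathrm{PSL}_2(\mathbb R)$ be a Fuchsian group (a discrete subgroup), acting on the upper half-plane $\mathbb H$ by fractional linear transformations, and assume that $\Gamma_0$ is cocompact, i.e. that $\Gamma_0\backslash\mathbb H$ is compact (such a group is automatically a Fuchsian group of the first kind). For a subgroup $\Gamma\subseteq\Gamma_0$ of finite index and an integer $k\ge 1$, let $\mathcal S_{2k}^{\Gamma}$ be the space of cusp forms of weight $2k$ for $\Gamma$, i.e. of holomorphic functions $f:\mathbb H\to\mathbb C$ with $f(\gamma z)=(cz+d)^{2k}f(z)$ for all $\gamma=\left(\begin{smallmatrix}a&b\\c&d\end{smallmatrix}\right)\in\Gamma$ which vanish at all cusps of $\Gamma$, with the Petersson inner product $$\langle f,g\rangle=\int_{\Gamma\backslash\mathbb H}f(z)\overline{g(z)}\,y^{2k}\,\frac{dx\,dy}{y^2}\qquad(z=x+iy).$$ Then there is a constant $C$, depending only on $\Gamma_0$, such that for every subgroup $\Gamma\subseteq\Gamma_0$ of finite index and every integer $k\ge 1$ the space $\mathcal S_{2k}^{\Gamma}$ is finite-dimensional and has an orthonormal basis, and for every orthonormal basis $f_1,\dots,f_d$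 of it the function $$S_k^{\Gamma}(z)=\sum_{j=1}^{d}|f_j(z)|^2\,\mathrm{Im}(z)^{2k}$$ satisfies $$\sup_{z\in\Gamma\backslash\mathbb H}S_k^{\Gamma}(z)\le C\,k.$$ -/

import Mathlib

open scoped MatrixGroups UpperHalfPlane Pointwise
open UpperHalfPlane MeasureTheory

namespace Fuchsian

/-- The action of `PSL(2, ℝ)` on `ℍ` by fractional linear transformations. -/
noncomputable instance pslAction : MulAction PSL(2, ℝ) ℍ :=
  MulAction.compHom ℍ (QuotientGroup.lift (Subgroup.center SL(2, ℝ))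
    (MulAction.toPermHom SL(2, ℝ) ℍ) (by
      intro g hg
      ext1 z
      have : (Matrix.SpecialLinearGroup.mapGL ℝ g) ∈ Subgroup.center (GL (Fin 2) ℝ) := by
        obtain ⟨r, hr, hg⟩ := Matrix.SpecialLinearGroup.mem_center_iff.mp hg
        rw [Matrix.GeneralLinearGroup.mem_center_iff_val_mem_range_scalar]
        exact ⟨r, by simpa using hg⟩
      exact (forall_smul_eq_self_iff_mem_center.mpr this) z))

theorem mk_smul (g : SL(2, ℝ)) (z : ℍ) : (QuotientGroup.mk g : PSL(2, ℝ)) • z = g • z := rfl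

theorem mk_eq_one_iff (g : SL(2, ℝ)) : (QuotientGroup.mk g : PSL(2, ℝ)) = 1 ↔
    Matrix.SpecialLinearGroup.mapGL ℝ g ∈ Subgroup.center (GL (Fin 2) ℝ) := by
  rw [QuotientGroup.eq_one_iff, Matrix.SpecialLinearGroup.mem_center_iff,
    Matrix.GeneralLinearGroup.mem_center_iff_val_mem_range_scalar]
  constructor
  · rintro ⟨r, -, h⟩
    exact ⟨r, by simpa using h⟩
  · rintro ⟨r, h⟩
    have h' : Matrix.scalar (Fin 2) r = (g : Matrix (Fin 2) (Fin 2) ℝ) := by simpa using h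
    refine ⟨r, ?_, h'⟩
    have := g.det_coe
    rw [← h'] at this
    simpa using this

theorem mk_smul_eq_self (g : PSL(2, ℝ)) (hg : g ≠ 1) : {z : ℍ | g • z = z}.Subsingleton := by
  induction g using QuotientGroup.induction_on with
  | H g =>
    intro z hz w hw
    have hd : 0 < (Matrix.SpecialLinearGroup.mapGL ℝ g).val.det := by simp
    have hz' : Matrix.SpecialLinearGroup.mapGL ℝ g • z = z := hz
    have hw' : Matrix.SpecialLinearGroup.mapGL ℝ g • w = w := hw
    have hell := isElliptic_of_exists_smul_eq_self hd
      (fun h => hg ((mk_eq_one_iff g).mpr h)) ⟨z, hz'⟩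
    rw [gl_smul_eq_self_iff_eq_fixedPt hd hell] at hz' hw'
    rw [hz', hw']

theorem volume_subsingleton {s : Set ℍ} (hs : s.Subsingleton) : (volume : Measure ℍ) s = 0 := by
  rw [volume_eq_lintegral, setLIntegral_measure_zero]
  exact (hs.image _).measure_zero _

instance pslSMulInvariant : SMulInvariantMeasure PSL(2, ℝ) ℍ volume := by
  constructor
  intro g s hs
  induction g using QuotientGroup.induction_on with
  | H g => exact measure_preimage_smul (volume : Measure ℍ) (Matrix.SpecialLinearGroup.mapGL ℝ g) s

instance pslContinuous : ContinuousConstSMul PSL(2, ℝ) ℍ := by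
  constructor
  intro g
  induction g using QuotientGroup.induction_on with
  | H g => exact continuous_const_smul (T := ℍ) g

theorem secondCountable_sl : SecondCountableTopology SL(2, ℝ) :=
  have : SecondCountableTopology (Matrix (Fin 2) (Fin 2) ℝ) :=
    inferInstanceAs (SecondCountableTopology (Fin 2 → Fin 2 → ℝ))
  Matrix.SpecialLinearGroup.isClosedEmbedding_val.toIsEmbedding.secondCountableTopology

theorem countable_of_discrete (Γ : Subgroup PSL(2, ℝ)) [DiscreteTopology Γ] : Countable Γ := by
  have := secondCountable_sl
  have : SecondCountableTopology PSL(2, ℝ) := inferInstance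
  exact countable_of_Lindelof_of_discrete

theorem discrete_comap (Γ : Subgroup PSL(2, ℝ)) [DiscreteTopology Γ] :
    DiscreteTopology (Γ.comap (QuotientGroup.mk' (Subgroup.center SL(2, ℝ)))) := by
  rw [discreteTopology_iff_isOpen_singleton_one]
  have h1 : IsOpen ({1} : Set Γ) := isOpen_discrete _
  obtain ⟨U, hU, hU1⟩ := isOpen_induced_iff.mp h1
  refine isOpen_induced_iff.mpr ⟨(QuotientGroup.mk ⁻¹' U) ∩ {g : SL(2, ℝ) | 0 < g 0 0},
    (hU.preimage QuotientGroup.continuous_mk).inter ?_, ?_⟩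
  · refine isOpen_lt continuous_const ?_
    exact (Matrix.SpecialLinearGroup.isClosedEmbedding_val.continuous).matrix_elem 0 0
  · ext ⟨g, hg⟩
    have key : ∀ h : Γ, (h : PSL(2, ℝ)) ∈ U ↔ h = 1 := fun h => by
      rw [← Set.mem_singleton_iff, ← hU1]; rfl
    simp only [Set.mem_preimage, Set.mem_inter_iff, Set.mem_ofPred_eq, Set.mem_singleton_iff]
    constructor
    · rintro ⟨h1, h2⟩
      have h3 := (key ⟨QuotientGroup.mk g, hg⟩).mp h1
      have h4 : (QuotientGroup.mk g : PSL(2, ℝ)) = 1 := congrArg Subtype.val h3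
      rw [QuotientGroup.eq_one_iff, Matrix.SpecialLinearGroup.mem_center_iff] at h4
      obtain ⟨r, hr, hg'⟩ := h4
      have h00 : g 0 0 = r := by rw [← hg']; simp
      have hr1 : r = 1 := by
        rw [h00] at h2
        have : r ^ 2 = 1 := by simpa using hr
        nlinarith
      ext i j
      change g i j = (1 : Matrix (Fin 2) (Fin 2) ℝ) i j
      rw [← hg', hr1]
      simp
    · intro h
      have h1 : g = 1 := congrArg Subtype.val h
      subst h1
      exact ⟨(key 1).mpr rfl, by simp⟩

theorem properlyDiscontinuous (Γ : Subgroup PSL(2, ℝ)) [DiscreteTopology Γ] :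
    ProperlyDiscontinuousSMul Γ ℍ := by
  have := discrete_comap Γ
  constructor
  intro K L hK hL
  have h := ProperlyDiscontinuousSMul.finite_disjoint_inter_image
    (Γ := (Γ.comap (QuotientGroup.mk' (Subgroup.center SL(2, ℝ))))) hK hL
  refine (h.image (fun g => (⟨QuotientGroup.mk g.1, g.2⟩ : Γ))).subset ?_
  rintro ⟨g, hg⟩ hne
  induction g using QuotientGroup.induction_on with
  | H g => exact ⟨⟨g, hg⟩, hne, rfl⟩

/-- A discrete subgroup of `PSL(2, ℝ)` has a fundamental domain in `ℍ`. -/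
theorem exists_isFundamentalDomain (Γ : Subgroup PSL(2, ℝ)) [DiscreteTopology Γ] :
    ∃ D : Set ℍ, IsFundamentalDomain Γ D volume := by
  have := countable_of_discrete Γ
  have := properlyDiscontinuous Γ
  have : ContinuousConstSMul Γ ℍ := ⟨fun γ => continuous_const_smul (γ : PSL(2, ℝ))⟩
  have hU : ∀ z : ℍ, ∃ U : Set ℍ, IsOpen U ∧ z ∈ U ∧
      ∀ γ : Γ, ∀ w ∈ U, γ • w ∈ U → γ • z = z := by
    intro z
    obtain ⟨V, hV, h⟩ := ProperlyDiscontinuousSMul.exists_nhds_image_smul_eq_self Γ z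
    obtain ⟨U, hUV, hU, hz⟩ := mem_nhds_iff.mp hV
    exact ⟨U, hU, hz, fun γ w hw hw' => h γ ⟨_, ⟨w, hUV hw, rfl⟩, hUV hw'⟩⟩
  choose U hUo hUz hUγ using hU
  let F : Set ℍ := {z | ∀ γ : Γ, γ • z = z → γ = 1}
  obtain ⟨T, hT, hTU⟩ := TopologicalSpace.isOpen_iUnion_countable (fun z : F => U z)
    (fun z => hUo z)
  have := hT.to_subtype
  obtain ⟨e, he⟩ := Countable.exists_injective_nat T
  let A : T → Set ℍ := fun t => ⋃ γ : Γ, (fun z => γ • z) ⁻¹' U t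
  have hA : ∀ t, MeasurableSet (A t) := fun t =>
    MeasurableSet.iUnion fun γ => ((hUo _).preimage (continuous_const_smul γ)).measurableSet
  have hAγ : ∀ t (γ : Γ) z, z ∈ A t → γ • z ∈ A t := by
    intro t γ z hz
    obtain ⟨δ, hδ⟩ := Set.mem_iUnion.mp hz
    exact Set.mem_iUnion.mpr ⟨δ * γ⁻¹, by simpa [smul_smul] using hδ⟩
  have hUA : ∀ t : T, U t ⊆ A t := fun t z hz => Set.mem_iUnion.mpr ⟨1, by simpa using hz⟩
  let D : Set ℍ := ⋃ t : T, U t \ ⋃ s : {s : T // e s < e t}, A s.1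
  have hD : MeasurableSet D := by
    refine MeasurableSet.iUnion fun t => MeasurableSet.diff ?_ (MeasurableSet.iUnion fun s => ?_)
    · exact (hUo _).measurableSet
    · exact hA _
  refine ⟨D, IsFundamentalDomain.mk'' ?_ ?_ ?_ ?_⟩
  · exact hD.nullMeasurableSet
  · have hF : volume Fᶜ = 0 := by
      refine measure_mono_null (t := ⋃ γ : {γ : Γ // γ ≠ 1}, {z : ℍ | (γ : Γ) • z = z}) ?_
        (measure_iUnion_null fun γ => volume_subsingleton
          (mk_smul_eq_self (γ : Γ) (fun h => γ.2 (Subtype.ext h))))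
      intro z hz
      simp only [F, Set.mem_compl_iff, Set.mem_ofPred_eq, not_forall] at hz
      obtain ⟨γ, h1, h2⟩ := hz
      exact Set.mem_iUnion.mpr ⟨⟨γ, h2⟩, h1⟩
    filter_upwards [compl_mem_ae_iff.mpr hF] with z hz
    have hz : z ∈ F := by simpa using hz
    have hex : ∃ t : T, z ∈ A t := by
      have : z ∈ ⋃ z : F, U z := Set.mem_iUnion.mpr ⟨⟨z, hz⟩, hUz z⟩
      rw [← hTU] at this
      obtain ⟨t, ht, hzt⟩ := Set.mem_iUnion₂.mp this
      exact ⟨⟨t, ht⟩, hUA ⟨t, ht⟩ hzt⟩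
    obtain ⟨t, ht, hmin⟩ := (measure e).wf.has_min {t | z ∈ A t} hex
    obtain ⟨γ, hγ⟩ := Set.mem_iUnion.mp ht
    refine ⟨γ, Set.mem_iUnion.mpr ⟨t, hγ, fun h => ?_⟩⟩
    obtain ⟨⟨s, hs⟩, h⟩ := Set.mem_iUnion.mp h
    exact hmin s (by simpa using hAγ s γ⁻¹ _ h) hs
  · intro γ hγ
    refine Disjoint.aedisjoint (Set.disjoint_left.mpr ?_)
    rintro _ ⟨w, hw, rfl⟩ hw'
    obtain ⟨t, ht, ht'⟩ := Set.mem_iUnion.mp hw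
    obtain ⟨s, hs, hs'⟩ := Set.mem_iUnion.mp hw'
    rcases lt_trichotomy (e s) (e t) with h | h | h
    · exact ht' (Set.mem_iUnion.mpr ⟨⟨s, h⟩, by simpa using hAγ s γ⁻¹ _ (hUA s hs)⟩)
    · obtain rfl := he h
      exact hγ ((s : F).2 γ (hUγ _ γ w ht hs))
    · exact hs' (Set.mem_iUnion.mpr ⟨⟨t, h⟩, hAγ t γ _ (hUA t ht)⟩)
  · exact fun γ => (measurePreserving_smul γ (volume : Measure ℍ)).quasiMeasurePreserving


/-- A Fuchsian group: a discrete subgroup of `PSL(2, ℝ)`, for the quotient topology. -/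
def IsFuchsian (Γ : Subgroup PSL(2, ℝ)) : Prop := DiscreteTopology Γ

/-- The quotient space `M = Γ \ ℍ`, with the quotient topology. -/
abbrev quotientSpace (Γ : Subgroup PSL(2, ℝ)) : Type := MulAction.orbitRel.Quotient Γ ℍ

/-- `Γ` is cocompact if `Γ \ ℍ` is compact. -/
def IsCocompact (Γ : Subgroup PSL(2, ℝ)) : Prop := CompactSpace (quotientSpace Γ)

/-- The group of all real matrices of determinant one whose class in `PSL(2, ℝ)` lies in `Γ`,
as a subgroup of `GL(2, ℝ)`. -/
def matrixGroup (Γ : Subgroup PSL(2, ℝ)) : Subgroup (GL (Fin 2) ℝ) :=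
  (Γ.comap (QuotientGroup.mk' (Subgroup.center SL(2, ℝ)))).map Matrix.SpecialLinearGroup.toGL

instance matrixGroup_hasDetOne (Γ : Subgroup PSL(2, ℝ)) : (matrixGroup Γ).HasDetOne := by
  unfold matrixGroup; infer_instance

/-- The space of cusp forms of weight `2k` for `Γ`: holomorphic functions `f` on `ℍ` such that
`f (γ z) = (c z + d) ^ (2 k) f z` for all `γ = [a, b; c, d]` in `Γ` (the sign of the matrix does
not matter, the weight being even), which vanish at all cusps of `Γ`. -/
abbrev CuspForms (Γ : Subgroup PSL(2, ℝ)) (k : ℕ) : Type := CuspForm (matrixGroup Γ) (2 * k : ℤ)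

/-- A fundamental domain for the action of `Γ` on `ℍ`, with respect to the hyperbolic area
`dx dy / y ^ 2` (the `volume` of `ℍ`). -/
noncomputable def fundamentalDomain (Γ : Subgroup PSL(2, ℝ)) : Set ℍ :=
  Classical.epsilon fun D : Set ℍ => IsFundamentalDomain Γ D volume

theorem isFundamentalDomain (Γ : Subgroup PSL(2, ℝ)) (hΓ : IsFuchsian Γ) :
    IsFundamentalDomain Γ (fundamentalDomain Γ) volume :=
  have : DiscreteTopology Γ := hΓ
  Classical.epsilon_spec (exists_isFundamentalDomain Γ)

/-- The Petersson inner product `∫_M f(z) conj(g(z)) y ^ (2k) dx dy / y ^ 2`. The integral over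
`M = Γ \ ℍ` of a `Γ`-invariant function is its integral over a fundamental domain; it does not
depend on which one. -/
noncomputable def peterssonInner (Γ : Subgroup PSL(2, ℝ)) (k : ℕ) (f g : CuspForms Γ k) : ℂ :=
  ∫ z in fundamentalDomain Γ, f z * (starRingEnd ℂ) (g z) * (z.im : ℂ) ^ (2 * k)

/-- `b` is an orthonormal basis `f_1, …, f_d` of the space of cusp forms of weight `2k` for
`Γ`, where `d` is the dimension of this space. -/
def IsOrthonormalBasis (Γ : Subgroup PSL(2, ℝ)) (k : ℕ)
    (b : Module.Basis (Fin (Module.finrank ℂ (CuspForms Γ k))) ℂ (CuspForms Γ k)) : Prop :=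
  ∀ i j, peterssonInner Γ k (b i) (b j) = if i = j then 1 else 0

/-- The function `S_k^Γ(z) = ∑_j |f_j(z)| ^ 2 Im(z) ^ (2k)` attached to a basis. -/
noncomputable def sumSq (Γ : Subgroup PSL(2, ℝ)) (k : ℕ)
    (b : Module.Basis (Fin (Module.finrank ℂ (CuspForms Γ k))) ℂ (CuspForms Γ k)) (z : ℍ) : ℝ :=
  ∑ j, ‖b j z‖ ^ 2 * z.im ^ (2 * k)

end Fuchsian

/-!
Fix `z` with imaginary part `y`. On the Euclidean disc of radius `y / (2 √k)` around `z`, the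
holomorphic function `(f(w) ((w - z̄) / (2 y)) ^ (2k)) ^ 2` has modulus at most
`e |f(w)| ^ 2 (Im w / y) ^ (2k)`, with `|f(z)| ^ 2` at the centre. Since that disc has hyperbolic
area of order `1 / k`, the mean value inequality bounds `|f(z)| ^ 2 y ^ (2k)` by a constant times
`k` times the integral of `|f| ^ 2 Im ^ (2k)` over the unit ball around `z`. That ball covers a
fundamental domain of `Γ` at most `N` times, where `N` depends only on `Γ₀`, so evaluation at `z`
has squared norm `O(N k)` as a functional for the Petersson norm, and the sum of the
`|f_j(z)| ^ 2 y ^ (2k)` over an orthonormal family is at most this squared norm. Integrating over a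
fundamental domain bounds the size of every orthonormal family: the space is finite-dimensional.
-/

namespace Fuchsian

theorem ofReal_two_pi_mul_enorm_le_lintegral_circleMap {E : Type*} [NormedAddCommGroup E]
    [NormedSpace ℂ E] [CompleteSpace E] {f : ℂ → E} {c : ℂ} {R : ℝ}
    (hf : DiffContOnCl ℂ f (Metric.ball c |R|)) :
    ENNReal.ofReal (2 * Real.pi) * ‖f c‖ₑ ≤
      ∫⁻ θ in Set.Ioo (-Real.pi) Real.pi, ‖f (circleMap c R θ)‖ₑ := by
  have mean_value : ∫ θ in Set.Ioo (-Real.pi) Real.pi, f (circleMap c R θ) =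
      (2 * Real.pi) • f c := by
    rw [← hf.circleAverage, Real.circleAverage_eq_integral_add (-Real.pi),
      intervalIntegral.integral_comp_add_right (fun θ => f (circleMap c R θ)),
      smul_inv_smul₀ Real.two_pi_pos.ne', ← integral_Ioc_eq_integral_Ioo,
      ← intervalIntegral.integral_of_le (by linarith [Real.pi_pos])]
    ring_nf
  calc ENNReal.ofReal (2 * Real.pi) * ‖f c‖ₑ
      = ‖∫ θ in Set.Ioo (-Real.pi) Real.pi, f (circleMap c R θ)‖ₑ := by
        rw [mean_value, enorm_smul, Real.enorm_eq_ofReal Real.two_pi_pos.le]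
    _ ≤ _ := enorm_integral_le_lintegral_enorm _

theorem lintegral_eq_lintegral_circleMap {F : ℂ → ENNReal} (hF : Measurable F) (c : ℂ) :
    ∫⁻ w, F w = ∫⁻ ρ in Set.Ioi (0 : ℝ), ENNReal.ofReal ρ *
      ∫⁻ θ in Set.Ioo (-Real.pi) Real.pi, F (circleMap c ρ θ) := by
  have hpolar (p : ℝ × ℝ) : c + Complex.polarCoord.symm p = circleMap c p.1 p.2 := by
    rw [Complex.polarCoord_symm_apply, circleMap, Complex.exp_mul_I, Complex.ofReal_cos,
      Complex.ofReal_sin]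
  rw [← lintegral_add_left_eq_self F c, ← Complex.lintegral_comp_polarCoord_symm,
    polarCoord_target, Measure.volume_eq_prod, ← Measure.prod_restrict, lintegral_prod]
  · simp only [hpolar, smul_eq_mul, lintegral_const_mul' _ _ ENNReal.ofReal_ne_top]
  · simp only [hpolar, circleMap]
    fun_prop

theorem volume_ball_mul_enorm_le_lintegral {E : Type*} [NormedAddCommGroup E]
    [NormedSpace ℂ E] [CompleteSpace E] {f : ℂ → E} {c : ℂ} {r : ℝ}
    (hf : DifferentiableOn ℂ f (Metric.ball c r)) :
    volume (Metric.ball c r) * ‖f c‖ₑ ≤ ∫⁻ w in Metric.ball c r, ‖f w‖ₑ := by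
  have hball : MeasurableSet (Metric.ball c r) := measurableSet_ball
  have hmeas : Measurable ((Metric.ball c r).indicator fun w => ‖f w‖ₑ) := by
    classical
    rw [← Set.piecewise_eq_indicator]
    exact hf.continuousOn.enorm.measurable_piecewise continuousOn_const hball
  have hconst : Measurable ((Metric.ball c r).indicator fun _ => ‖f c‖ₑ) :=
    measurable_const.indicator hball
  rw [mul_comm, ← setLIntegral_const, ← lintegral_indicator hball, ← lintegral_indicator hball,
    lintegral_eq_lintegral_circleMap hmeas c, lintegral_eq_lintegral_circleMap hconst c]
  refine setLIntegral_mono' measurableSet_Ioi fun ρ (hρ : 0 < ρ) => mul_le_mul_right ?_ _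
  have hmem (θ : ℝ) : circleMap c ρ θ ∈ Metric.ball c r ↔ ρ < r := by
    rw [mem_ball_iff_norm, circleMap_sub_center, norm_circleMap_zero, abs_of_pos hρ]
  by_cases hρr : ρ < r
  · have hdiff : DiffContOnCl ℂ f (Metric.ball c |ρ|) :=
      (hf.mono (Metric.closedBall_subset_ball (by rwa [abs_of_pos hρ]))).diffContOnCl_ball
        subset_rfl
    simpa [Set.indicator, hmem, hρr, mul_comm, ← two_mul] using
      ofReal_two_pi_mul_enorm_le_lintegral_circleMap hdiff
  · simp [Set.indicator, hmem, hρr]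

theorem comap_coe_volume_eq_withDensity :
    (volume : Measure ℂ).comap UpperHalfPlane.coe =
      (volume : Measure ℍ).withDensity fun w => ENNReal.ofReal (w.im ^ 2) := by
  have hdensity : (fun w : ℍ => (((1 / NNReal.mk w.im w.im_pos.le : NNReal) ^ 2 : NNReal) :
      ENNReal)) = fun w : ℍ => (ENNReal.ofReal (w.im ^ 2))⁻¹ := by
    funext w
    rw [← ENNReal.ofReal_inv_of_pos (pow_pos w.im_pos 2), ENNReal.ofReal, ENNReal.coe_inj]
    ext
    simp [w.im_pos.le]
  have hinv := withDensity_inv_same (μ := (volume : Measure ℂ).comap UpperHalfPlane.coe)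
    (f := fun w : ℍ => (ENNReal.ofReal (w.im ^ 2))⁻¹) (by fun_prop) (by simp)
    (ae_of_all _ fun w => by simp [w.im_ne_zero])
  simpa only [volume_def, hdensity, inv_inv] using hinv.symm

theorem setLIntegral_image_coe {s : Set ℍ} (hs : MeasurableSet s) (F : ℂ → ENNReal) :
    ∫⁻ w in UpperHalfPlane.coe '' s, F w =
      ∫⁻ w in s, ENNReal.ofReal (w.im ^ 2) * F w := by
  have hcoe : MeasurePreserving UpperHalfPlane.coe (volume.comap UpperHalfPlane.coe)
      (volume.restrict (.range UpperHalfPlane.coe)) :=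
    ⟨measurable_coe, measurableEmbedding_coe.map_comap volume⟩
  calc ∫⁻ w in UpperHalfPlane.coe '' s, F w
      = ∫⁻ w in s, F w ∂((volume : Measure ℂ).comap UpperHalfPlane.coe) := by
        rw [hcoe.setLIntegral_comp_emb measurableEmbedding_coe,
          Measure.restrict_restrict_of_subset (Set.image_subset_range _ _)]
    _ = _ := by
        rw [comap_coe_volume_eq_withDensity,
          setLIntegral_withDensity_eq_setLIntegral_mul_non_measurable _ (by fun_prop) _ hs
            (by simp)]
        rfl

/-- The function `|f| ^ 2 y ^ (2k)`, which is invariant under `Γ` when `f` is automorphic of weight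
`2k` for `Γ`; its hyperbolic integral is the squared Petersson norm. -/
noncomputable def invariantNormSq (k : ℕ) (f : ℍ → ℂ) (z : ℍ) : ℝ :=
  ‖f z‖ ^ 2 * z.im ^ (2 * k)

/-- The factor `(w - z̄) / (2 Im z)`, normalised to have modulus one at `w = z`. Multiplication by
its `2k`-th power transfers forms of weight `2k` to the disc model centred at `z`. -/
noncomputable def discFactor (z : ℍ) (w : ℂ) : ℂ :=
  (w - (starRingEnd ℂ) z) / (2 * z.im)

theorem norm_discFactor_self (z : ℍ) : ‖discFactor z z‖ = 1 := by
  have : (z : ℂ).im ≠ 0 := z.im_ne_zero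
  simp [discFactor, Complex.sub_conj, UpperHalfPlane.im_ne_zero]

theorem norm_discFactor_sq (z : ℍ) (w : ℂ) :
    ‖discFactor z w‖ ^ 2 = w.im / z.im + (dist w z / (2 * z.im)) ^ 2 := by
  have him := z.im_ne_zero
  simp only [discFactor, dist_eq_norm, norm_div, div_pow, ← Complex.normSq_eq_norm_sq,
    Complex.normSq_apply, Complex.sub_re, Complex.sub_im, Complex.conj_re, Complex.conj_im,
    Complex.mul_re, Complex.mul_im, Complex.ofReal_re, Complex.ofReal_im, Complex.re_ofNat,
    Complex.im_ofNat, coe_re, coe_im]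
  field_simp
  ring

theorem add_pow_le_exp_mul_pow {t δ : ℝ} (ht : 0 < t) (hδ : 0 ≤ δ) (n : ℕ) :
    (t + δ) ^ n ≤ Real.exp (n * (δ / t)) * t ^ n := by
  rw [Real.exp_nat_mul, ← mul_pow]
  gcongr
  calc t + δ = (δ / t + 1) * t := by field_simp; ring
    _ ≤ Real.exp (δ / t) * t := by gcongr; exact Real.add_one_le_exp _

theorem abs_im_sub_im_le_dist (w z : ℂ) : |w.im - z.im| ≤ dist w z := by
  rw [dist_eq_norm, ← Complex.sub_im]
  exact Complex.abs_im_le_norm _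

theorem im_mem_Icc_of_dist_coe_le {w z : ℍ} (h : dist (w : ℂ) z ≤ z.im / 2) :
    w.im ∈ Set.Icc (z.im / 2) (3 / 2 * z.im) := by
  have him := abs_le.mp ((abs_im_sub_im_le_dist w z).trans h)
  rw [coe_im, coe_im] at him
  constructor <;> linarith

theorem dist_le_one_of_dist_coe_le {w z : ℍ} (h : dist (w : ℂ) z ≤ z.im / 2) :
    dist w z ≤ 1 := by
  refine (dist_le_dist_coe_div_sqrt w z).trans
    ((div_le_one (Real.sqrt_pos.mpr (mul_pos w.im_pos z.im_pos))).mpr ?_)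
  refine h.trans (Real.le_sqrt_of_sq_le ?_)
  nlinarith [z.im_pos, (im_mem_Icc_of_dist_coe_le h).1]

theorem ball_coe_subset_im_pos {z : ℍ} {r : ℝ} (hr : r ≤ z.im) :
    Metric.ball (z : ℂ) r ⊆ {w | 0 < w.im} := fun w hw => by
  have him := neg_lt_of_abs_lt ((abs_im_sub_im_le_dist w z).trans_lt hw)
  rw [coe_im] at him
  rw [Set.mem_ofPred_eq]
  linarith

theorem volume_ball_mul_enorm_le_lintegral_preimage_coe {E : Type*} [NormedAddCommGroup E]
    [NormedSpace ℂ E] [CompleteSpace E] {h : ℂ → E} {z : ℍ} {r : ℝ} (hr : r ≤ z.im)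
    (hh : DifferentiableOn ℂ h (Metric.ball (z : ℂ) r)) :
    volume (Metric.ball (z : ℂ) r) * ‖h z‖ₑ ≤
      ∫⁻ w in UpperHalfPlane.coe ⁻¹' Metric.ball (z : ℂ) r,
        ENNReal.ofReal (w.im ^ 2) * ‖h w‖ₑ := by
  rw [← setLIntegral_image_coe (measurable_coe measurableSet_ball) fun w => ‖h w‖ₑ,
    Set.image_preimage_eq_of_subset fun w hw => ⟨⟨w, ball_coe_subset_im_pos hr hw⟩, rfl⟩]
  exact volume_ball_mul_enorm_le_lintegral hh

theorem div_two_mul_sqrt_le_half {y : ℝ} (hy : 0 ≤ y) {k : ℕ} (hk : 0 < k) :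
    y / (2 * √k) ≤ y / 2 := by
  have : 1 ≤ √(k : ℝ) := Real.one_le_sqrt.mpr (by exact_mod_cast hk)
  gcongr
  linarith

theorem norm_discFactor_pow_le {k : ℕ} (hk : 0 < k) {z w : ℍ}
    (h : dist (w : ℂ) z ≤ z.im / (2 * √k)) :
    ‖discFactor z w‖ ^ (4 * k) ≤ Real.exp 1 * (w.im / z.im) ^ (2 * k) := by
  have hz := z.im_pos
  have hk' : (0 : ℝ) < k := by exact_mod_cast hk
  have hratio : 1 / 2 ≤ w.im / z.im := by
    rw [le_div_iff₀ hz]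
    linarith [(im_mem_Icc_of_dist_coe_le (h.trans (div_two_mul_sqrt_le_half hz.le hk))).1]
  have hdist : (dist (w : ℂ) z / (2 * z.im)) ^ 2 ≤ 1 / (16 * k) := by
    calc (dist (w : ℂ) z / (2 * z.im)) ^ 2
        ≤ (z.im / (2 * √k) / (2 * z.im)) ^ 2 := by gcongr
      _ = 1 / (16 * √k ^ 2) := by field_simp; norm_num
      _ = 1 / (16 * k) := by rw [Real.sq_sqrt hk'.le]
  have hexp : ((2 * k : ℕ) : ℝ) * ((dist (w : ℂ) z / (2 * z.im)) ^ 2 / (w.im / z.im)) ≤ 1 := by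
    calc _ ≤ ((2 * k : ℕ) : ℝ) * (1 / (16 * k) / (1 / 2)) := by gcongr
      _ ≤ 1 := by push_cast; field_simp; norm_num
  calc ‖discFactor z w‖ ^ (4 * k)
      = (w.im / z.im + (dist (w : ℂ) z / (2 * z.im)) ^ 2) ^ (2 * k) := by
        rw [← coe_im w, ← norm_discFactor_sq, ← pow_mul]
        ring_nf
    _ ≤ _ := add_pow_le_exp_mul_pow (div_pos w.im_pos hz) (sq_nonneg _) _
    _ ≤ _ := by gcongr

theorem invariantNormSq_nonneg (k : ℕ) (f : ℍ → ℂ) (z : ℍ) : 0 ≤ invariantNormSq k f z :=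
  mul_nonneg (sq_nonneg _) (pow_nonneg z.im_pos.le _)

/-- The square of the function on the disc model centred at `z` attached to `f` in weight `2k`,
written in the coordinate `w` of the half-plane. It is squared so that its modulus is comparable
to `invariantNormSq k f` while it remains holomorphic. -/
noncomputable def discLiftSq (k : ℕ) (f : ℍ → ℂ) (z : ℍ) (w : ℂ) : ℂ :=
  (f (ofComplex w) * discFactor z w ^ (2 * k)) ^ 2

theorem norm_discLiftSq (k : ℕ) (f : ℍ → ℂ) (z w : ℍ) :
    ‖discLiftSq k f z w‖ = ‖f w‖ ^ 2 * ‖discFactor z w‖ ^ (4 * k) := by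
  simp only [discLiftSq, ofComplex_apply, norm_pow, norm_mul, mul_pow, ← pow_mul]
  ring_nf

theorem differentiableOn_discLiftSq (k : ℕ) {f : ℍ → ℂ}
    (hf : DifferentiableOn ℂ (f ∘ ofComplex) {z | 0 < z.im}) (z : ℍ) :
    DifferentiableOn ℂ (discLiftSq k f z) {w | 0 < w.im} := by
  have hdisc : Differentiable ℂ (discFactor z) := by unfold discFactor; fun_prop
  exact (hf.mul (hdisc.pow _).differentiableOn).pow 2

theorem im_pow_mul_norm_discLiftSq_le {k : ℕ} (hk : 0 < k) (f : ℍ → ℂ) {z w : ℍ}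
    (h : dist (w : ℂ) z ≤ z.im / (2 * √k)) :
    z.im ^ (2 * k) * (w.im ^ 2 * ‖discLiftSq k f z w‖) ≤
      9 / 4 * Real.exp 1 * z.im ^ 2 * invariantNormSq k f w := by
  have hz := z.im_pos
  have := w.im_pos.le
  have him : w.im ≤ 3 / 2 * z.im :=
    (im_mem_Icc_of_dist_coe_le (h.trans (div_two_mul_sqrt_le_half hz.le hk))).2
  calc z.im ^ (2 * k) * (w.im ^ 2 * ‖discLiftSq k f z w‖)
      ≤ z.im ^ (2 * k) * ((3 / 2 * z.im) ^ 2 *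
          (‖f w‖ ^ 2 * (Real.exp 1 * (w.im / z.im) ^ (2 * k)))) := by
        rw [norm_discLiftSq]
        gcongr
        exact norm_discFactor_pow_le hk h
    _ = _ := by
        rw [invariantNormSq, div_pow w.im]
        field_simp
        ring

theorem volume_ball_mul_invariantNormSq_le {k : ℕ} (hk : 0 < k) {f : ℍ → ℂ}
    (hf : DifferentiableOn ℂ (f ∘ ofComplex) {z | 0 < z.im}) (z : ℍ) :
    volume (Metric.ball (z : ℂ) (z.im / (2 * √k))) * ENNReal.ofReal (invariantNormSq k f z) ≤
      ENNReal.ofReal (9 / 4 * Real.exp 1 * z.im ^ 2) *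
        ∫⁻ w in Metric.closedBall z 1, ENNReal.ofReal (invariantNormSq k f w) := by
  have hz := z.im_pos
  set r : ℝ := z.im / (2 * √k)
  have hr : r ≤ z.im / 2 := div_two_mul_sqrt_le_half hz.le hk
  set s : Set ℍ := UpperHalfPlane.coe ⁻¹' Metric.ball (z : ℂ) r
  have hs : MeasurableSet s := measurable_coe measurableSet_ball
  have hs_closedBall : s ⊆ Metric.closedBall z 1 := fun w (hw : dist (w : ℂ) z < r) =>
    dist_le_one_of_dist_coe_le (hw.le.trans hr)
  have mean_value := volume_ball_mul_enorm_le_lintegral_preimage_coe (hr.trans (half_le_self hz.le))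
    ((differentiableOn_discLiftSq k hf z).mono
      (ball_coe_subset_im_pos (hr.trans (half_le_self hz.le))))
  calc volume (Metric.ball (z : ℂ) r) * ENNReal.ofReal (invariantNormSq k f z)
      = ENNReal.ofReal (z.im ^ (2 * k)) *
          (volume (Metric.ball (z : ℂ) r) * ‖discLiftSq k f z z‖ₑ) := by
        rw [← ofReal_norm, norm_discLiftSq, norm_discFactor_self, one_pow, mul_one,
          invariantNormSq, ENNReal.ofReal_mul (sq_nonneg _)]
        ring
    _ ≤ ∫⁻ w in s, ENNReal.ofReal (z.im ^ (2 * k)) *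
          (ENNReal.ofReal (w.im ^ 2) * ‖discLiftSq k f z w‖ₑ) := by
        rw [lintegral_const_mul' _ _ ENNReal.ofReal_ne_top]
        gcongr
    _ ≤ ∫⁻ w in s, ENNReal.ofReal (9 / 4 * Real.exp 1 * z.im ^ 2) *
          ENNReal.ofReal (invariantNormSq k f w) := by
        refine setLIntegral_mono' hs fun w (hw : dist (w : ℂ) z < r) => ?_
        rw [← ofReal_norm, ← ENNReal.ofReal_mul (sq_nonneg _), ← ENNReal.ofReal_mul (by positivity),
          ← ENNReal.ofReal_mul (by positivity)]
        exact ENNReal.ofReal_le_ofReal (im_pow_mul_norm_discLiftSq_le hk f hw.le)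
    _ ≤ _ := by
        rw [lintegral_const_mul' _ _ ENNReal.ofReal_ne_top]
        gcongr

theorem ofReal_invariantNormSq_le_lintegral_closedBall {k : ℕ} (hk : 0 < k) {f : ℍ → ℂ}
    (hf : DifferentiableOn ℂ (f ∘ ofComplex) {z | 0 < z.im}) (z : ℍ) :
    ENNReal.ofReal (invariantNormSq k f z) ≤ ENNReal.ofReal (9 * k) *
      ∫⁻ w in Metric.closedBall z 1, ENNReal.ofReal (invariantNormSq k f w) := by
  have := z.im_pos
  have hk' : (0 : ℝ) < k := by exact_mod_cast hk
  have hvol : volume (Metric.ball (z : ℂ) (z.im / (2 * √k))) =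
      ENNReal.ofReal (Real.pi * z.im ^ 2 / (4 * k)) := by
    rw [Complex.volume_ball, ← ENNReal.ofReal_pow (by positivity), ← ENNReal.ofReal_coe_nnreal,
      ← ENNReal.ofReal_mul (by positivity), div_pow, mul_pow, Real.sq_sqrt hk'.le,
      NNReal.coe_real_pi]
    ring_nf
  have hconst : 9 / 4 * Real.exp 1 * z.im ^ 2 ≤ Real.pi * z.im ^ 2 / (4 * k) * (9 * k) := by
    have : Real.exp 1 ≤ Real.pi := by linarith [Real.exp_one_lt_d9, Real.pi_gt_three]
    calc _ ≤ 9 / 4 * Real.pi * z.im ^ 2 := by gcongr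
      _ = _ := by field_simp
  have hne : ENNReal.ofReal (Real.pi * z.im ^ 2 / (4 * k)) ≠ 0 := by
    rw [Ne, ENNReal.ofReal_eq_zero, not_le]
    positivity
  refine (ENNReal.mul_le_mul_iff_right hne ENNReal.ofReal_ne_top).mp ?_
  rw [← mul_assoc, ← ENNReal.ofReal_mul (q := 9 * k) (by positivity), ← hvol]
  refine (volume_ball_mul_invariantNormSq_le hk hf z).trans ?_
  gcongr

section GroupAction

variable {G X : Type*} [Group G] [MulAction G X]

theorem exists_isCompact_forall_exists_smul_mem (G X : Type*) [Group G] [TopologicalSpace X]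
    [MulAction G X] [ContinuousConstSMul G X] [WeaklyLocallyCompactSpace X]
    [CompactSpace (MulAction.orbitRel.Quotient G X)] :
    ∃ K : Set X, IsCompact K ∧ ∀ x, ∃ g : G, g • x ∈ K := by
  let π : X → MulAction.orbitRel.Quotient G X := Quotient.mk''
  have hπ : IsOpenMap π := isOpenMap_quotient_mk'_mul
  choose K hK hKx using fun x : X => exists_compact_mem_nhds x
  obtain ⟨t, ht⟩ := isCompact_univ.elim_finite_subcover (fun x => π '' interior (K x))
    (fun x => hπ _ isOpen_interior) fun q _ => by
      obtain ⟨x, rfl⟩ := Quotient.exists_rep q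
      exact Set.mem_iUnion.mpr ⟨x, x, mem_interior_iff_mem_nhds.mpr (hKx x), rfl⟩
  refine ⟨⋃ x ∈ t, K x, t.isCompact_biUnion fun x _ => hK x, fun x => ?_⟩
  obtain ⟨y, hyt, w, hw, hwx⟩ := Set.mem_iUnion₂.mp (ht (Set.mem_univ (π x)))
  obtain ⟨g, rfl⟩ := MulAction.orbitRel_apply.mp (Quotient.exact hwx)
  exact ⟨g, Set.mem_biUnion hyt (interior_subset hw)⟩

theorem compactSpace_orbitRel_quotient [TopologicalSpace X] {K : Set X} (hK : IsCompact K)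
    (hcover : ∀ x, ∃ g : G, g • x ∈ K) : CompactSpace (MulAction.orbitRel.Quotient G X) := by
  have himage : Quotient.mk (MulAction.orbitRel G X) '' K = Set.univ := by
    refine Set.eq_univ_of_forall fun q => ?_
    obtain ⟨x, rfl⟩ := Quotient.exists_rep q
    obtain ⟨g, hg⟩ := hcover x
    exact ⟨g • x, hg, Quotient.sound (MulAction.orbitRel_apply.mpr ⟨g, rfl⟩)⟩
  exact ⟨himage ▸ hK.image continuous_quotient_mk'⟩

theorem compactSpace_orbitRel_quotient_of_isFiniteRelIndex [TopologicalSpace X]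
    [ContinuousConstSMul G X] [WeaklyLocallyCompactSpace X] {H H₀ : Subgroup G}
    [H.IsFiniteRelIndex H₀] [CompactSpace (MulAction.orbitRel.Quotient H₀ X)] :
    CompactSpace (MulAction.orbitRel.Quotient H X) := by
  have : ContinuousConstSMul H₀ X := ⟨fun g => continuous_const_smul (g : G)⟩
  obtain ⟨K, hK, hcover⟩ := exists_isCompact_forall_exists_smul_mem H₀ X
  have : (H.subgroupOf H₀).FiniteIndex := Subgroup.IsFiniteRelIndex.to_finiteIndex_subgroupOf
  have : Finite (H₀ ⧸ H.subgroupOf H₀) := Subgroup.finite_quotient_of_finiteIndex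
  refine compactSpace_orbitRel_quotient
    (isCompact_iUnion fun q : H₀ ⧸ H.subgroupOf H₀ => hK.smul q.out⁻¹) fun x => ?_
  obtain ⟨g, hg⟩ := hcover x
  obtain ⟨t, ht⟩ := QuotientGroup.mk_out_eq_mul (H.subgroupOf H₀) g
  refine ⟨⟨t, t.2⟩⁻¹, Set.mem_iUnion.mpr ⟨QuotientGroup.mk g, ?_⟩⟩
  have hg_smul : (g * t) • (t : H₀)⁻¹ • x = g • x := by rw [mul_smul, smul_inv_smul]
  rw [ht, Set.mem_smul_set_iff_inv_smul_mem, inv_inv]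
  exact hg_smul ▸ hg

theorem exists_forall_encard_smul_mem_closedBall_le (G X : Type*) [Group G] [PseudoMetricSpace X]
    [ProperSpace X] [MulAction G X] [IsIsometricSMul G X] [ProperlyDiscontinuousSMul G X]
    [CompactSpace (MulAction.orbitRel.Quotient G X)] (r : ℝ) :
    ∃ N : ℕ, ∀ x z : X, {g : G | g • x ∈ Metric.closedBall z r}.encard ≤ N := by
  obtain ⟨K, hK, hcover⟩ := exists_isCompact_forall_exists_smul_mem G X
  have hfinite := ProperlyDiscontinuousSMul.finite_disjoint_inter_image (Γ := G) hK
    (hK.cthickening (r := r))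
  refine ⟨hfinite.toFinset.card, fun x z => ?_⟩
  obtain ⟨a, ha⟩ := hcover z
  obtain ⟨b, hb⟩ := hcover x
  rw [← Set.encard_coe_eq_coe_finsetCard, hfinite.coe_toFinset]
  refine Set.encard_le_encard_of_injOn (f := fun g => a * g * b⁻¹) (fun g hg => ?_)
    fun g _ h _ hgh => by simpa using hgh
  refine ⟨(a * g) • x, ⟨b • x, hb, by simp [smul_smul]⟩, ?_⟩
  refine Metric.mem_cthickening_of_dist_le _ (a • z) _ _ ha ?_
  rwa [mul_smul, dist_smul]

theorem encard_smul_mem_le_of_le {H H₀ : Subgroup G} (h : H ≤ H₀) (x : X) (B : Set X) :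
    {g : H | g • x ∈ B}.encard ≤ {g : H₀ | g • x ∈ B}.encard :=
  Set.encard_le_encard_of_injOn (f := Subgroup.inclusion h) (fun _ hg => hg)
    (Subgroup.inclusion_injective h).injOn

variable [Countable G] [MeasurableSpace X] [MeasurableConstSMul G X] {μ : Measure X}
  [SMulInvariantMeasure G X μ] {D : Set X}

theorem setLIntegral_le_mul_setLIntegral_fundamentalDomain (hD : IsFundamentalDomain G D μ)
    {B : Set X} (hB : MeasurableSet B) {N : ℕ} (hN : ∀ x, {g : G | g • x ∈ B}.encard ≤ N)
    {F : X → ENNReal} (hF : Measurable F) (hF_inv : ∀ (g : G) x, F (g • x) = F x) :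
    ∫⁻ x in B, F x ∂μ ≤ N * ∫⁻ x in D, F x ∂μ := by
  have hmeas : ∀ g : G, AEMeasurable (fun x => B.indicator F (g • x)) (μ.restrict D) := fun g =>
    ((hF.indicator hB).comp (measurable_const_smul g)).aemeasurable
  rw [← lintegral_indicator hB, hD.lintegral_eq_tsum'',
    ← lintegral_tsum hmeas, ← lintegral_const_mul _ hF]
  refine lintegral_mono fun x => ?_
  have hterm (g : G) :
      B.indicator F (g • x) = {g : G | g • x ∈ B}.indicator (fun _ => F x) g := by
    classical
    simp only [Set.indicator_apply, Set.mem_ofPred_eq, hF_inv]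
  simp_rw [hterm]
  rw [← tsum_subtype, ENNReal.tsum_set_const]
  gcongr
  exact_mod_cast hN x

theorem measure_fundamentalDomain_le (hD : IsFundamentalDomain G D μ) {K : Set X}
    (hK : ∀ x, ∃ g : G, g • x ∈ K) : μ D ≤ μ K := by
  rw [hD.measure_eq_tsum K]
  refine le_trans (measure_mono fun x hx => ?_) (measure_iUnion_le _)
  obtain ⟨g, hg⟩ := hK x
  exact Set.mem_iUnion.mpr ⟨g⁻¹, Set.mem_inv_smul_set_iff.mpr hg, hx⟩

end GroupAction

section Orthonormal

variable {𝕜 V ι : Type*} [RCLike 𝕜] [NormedAddCommGroup V] [InnerProductSpace 𝕜 V]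

theorem sum_norm_sq_le_of_orthonormal [Fintype ι] {e : V →ₗ[𝕜] 𝕜} {C : ℝ} (hC : 0 ≤ C)
    (he : ∀ f, ‖e f‖ ^ 2 ≤ C * ‖f‖ ^ 2) {v : ι → V} (hv : Orthonormal 𝕜 v) :
    ∑ i, ‖e (v i)‖ ^ 2 ≤ C := by
  set S : ℝ := ∑ i, ‖e (v i)‖ ^ 2
  set f : V := ∑ i, (starRingEnd 𝕜) (e (v i)) • v i with hf
  have hS : 0 ≤ S := Finset.sum_nonneg fun i _ => sq_nonneg _
  have hef : e f = (S : 𝕜) := by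
    simp only [hf, S, map_sum, map_smul, smul_eq_mul, RCLike.conj_mul, RCLike.ofReal_pow]
  have hf_norm : ‖f‖ ^ 2 = S := by
    have := hv.inner_sum (fun i => (starRingEnd 𝕜) (e (v i)))
      (fun i => (starRingEnd 𝕜) (e (v i))) Finset.univ
    rw [← RCLike.ofReal_inj (K := 𝕜), RCLike.ofReal_pow, ← inner_self_eq_norm_sq_to_K, this]
    simp [S, RCLike.mul_conj]
  have hSS : S * S ≤ C * S := by
    simpa [hef, hf_norm, abs_of_nonneg hS, sq] using he f
  rcases hS.eq_or_lt with hS_zero | hS_pos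
  · exact hS_zero ▸ hC
  · exact le_of_mul_le_mul_right hSS hS_pos

theorem finite_of_orthonormal_card_le (n : ℕ)
    (h : ∀ (d : ℕ) (v : Fin d → V), Orthonormal 𝕜 v → d ≤ n) : Module.Finite 𝕜 V := by
  rw [← Module.rank_lt_aleph0_iff]
  refine lt_of_le_of_lt (rank_le (n := n) fun s hs => ?_) Cardinal.natCast_lt_aleph0
  let W := Submodule.span 𝕜 (s : Set V)
  have : FiniteDimensional 𝕜 W := FiniteDimensional.span_finset 𝕜 s
  rw [← finrank_span_finset_eq_card hs]
  exact h _ _ ((stdOrthonormalBasis 𝕜 W).orthonormal.comp_linearIsometry W.subtypeₗᵢ)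

theorem finite_of_integral_norm_sq_eq {X : Type*} [MeasurableSpace X] {μ : Measure X}
    [IsFiniteMeasure μ] {e : X → V →ₗ[𝕜] 𝕜} {C : ℝ} (hC : 0 ≤ C)
    (he_int : ∀ f, ∫ x, ‖e x f‖ ^ 2 ∂μ = ‖f‖ ^ 2) (he : ∀ x f, ‖e x f‖ ^ 2 ≤ C * ‖f‖ ^ 2) :
    Module.Finite 𝕜 V := by
  refine finite_of_orthonormal_card_le (𝕜 := 𝕜) ⌈C * μ.real Set.univ⌉₊ fun d v hv => ?_
  have hint (i : Fin d) : Integrable (fun x => ‖e x (v i)‖ ^ 2) μ :=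
    .of_integral_ne_zero (by simp [he_int, hv.norm_eq_one])
  have hd : (d : ℝ) ≤ C * μ.real Set.univ := by
    calc (d : ℝ) = ∑ i, ∫ x, ‖e x (v i)‖ ^ 2 ∂μ := by simp [he_int, hv.norm_eq_one]
      _ = ∫ x, ∑ i, ‖e x (v i)‖ ^ 2 ∂μ := (integral_finsetSum _ fun i _ => hint i).symm
      _ ≤ ∫ _, C ∂μ := integral_mono (integrable_finsetSum _ fun i _ => hint i)
        (integrable_const C) fun x => sum_norm_sq_le_of_orthonormal hC (he x) hv
      _ = C * μ.real Set.univ := by rw [integral_const, smul_eq_mul, mul_comm]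
  exact_mod_cast hd.trans (Nat.le_ceil _)

end Orthonormal

section Petersson

attribute [local instance] countable_of_discrete properlyDiscontinuous

instance isOpenPosMeasure_volume : (volume : Measure ℍ).IsOpenPosMeasure where
  open_pos U hU hne hzero := by
    have himage := setLIntegral_image_coe hU.measurableSet fun _ => 1
    rw [setLIntegral_measure_zero _ _ hzero, setLIntegral_one] at himage
    exact (isOpenEmbedding_coe.isOpenMap _ hU).measure_ne_zero volume (hne.image _) himage

instance isIsometricSMul_psl : IsIsometricSMul PSL(2, ℝ) ℍ where
  isometry_smul g := by
    induction g using QuotientGroup.induction_on with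
    | H g => exact isometry_smul ℍ g

instance (Γ : Subgroup PSL(2, ℝ)) : IsIsometricSMul Γ ℍ where
  isometry_smul g := isometry_smul ℍ (g : PSL(2, ℝ))

variable {Γ : Subgroup PSL(2, ℝ)} {k : ℕ}

theorem petersson_self (f : ℍ → ℂ) (z : ℍ) :
    petersson (2 * k : ℤ) f f z = (invariantNormSq k f z : ℂ) := by
  rw [petersson, Complex.conj_mul', invariantNormSq]
  push_cast
  norm_cast

theorem norm_petersson_self (f : ℍ → ℂ) (z : ℍ) :
    ‖petersson (2 * k : ℤ) f f z‖ = invariantNormSq k f z := by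
  rw [petersson_self, Complex.norm_real, Real.norm_of_nonneg (invariantNormSq_nonneg k f z)]

theorem petersson_smul (f g : CuspForms Γ k) (γ : Γ) (z : ℍ) :
    petersson (2 * k : ℤ) f g (γ • z) = petersson (2 * k : ℤ) f g z := by
  obtain ⟨γ, hγ⟩ := γ
  induction γ using QuotientGroup.induction_on with
  | H γ =>
    have hmem : Matrix.SpecialLinearGroup.toGL γ ∈ matrixGroup Γ := ⟨γ, hγ, rfl⟩
    exact SlashInvariantFormClass.petersson_smul (f := f) (f' := g) (τ := z) hmem

theorem continuous_petersson (f g : CuspForms Γ k) : Continuous (petersson (2 * k : ℤ) f g) :=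
  petersson_continuous _ (ModularFormClass.continuous f) (ModularFormClass.continuous g)

theorem invariantNormSq_smul (f : CuspForms Γ k) (γ : Γ) (z : ℍ) :
    invariantNormSq k f (γ • z) = invariantNormSq k f z := by
  rw [← norm_petersson_self, petersson_smul, norm_petersson_self]

theorem continuous_invariantNormSq (f : CuspForms Γ k) : Continuous (invariantNormSq k f) :=
  (continuous_petersson f f).norm.congr fun z => norm_petersson_self f z

theorem peterssonInner_eq_setIntegral_petersson (f g : CuspForms Γ k) :
    peterssonInner Γ k f g = ∫ z in fundamentalDomain Γ, petersson (2 * k : ℤ) g f z := by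
  refine integral_congr_ae (ae_of_all _ fun z => ?_)
  simp only [petersson]
  rw [mul_comm (f z)]
  norm_cast

theorem peterssonInner_self (f : CuspForms Γ k) :
    peterssonInner Γ k f f = ((∫ z in fundamentalDomain Γ, invariantNormSq k f z : ℝ) : ℂ) := by
  simp_rw [peterssonInner_eq_setIntegral_petersson, petersson_self]
  exact integral_ofReal

/-- Evaluation at `z` weighted by `Im(z) ^ k`, the linear functional on cusp forms of weight `2k`
whose squared modulus is `invariantNormSq`. -/
noncomputable def weightedEval (k : ℕ) (z : ℍ) : CuspForms Γ k →ₗ[ℂ] ℂ where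
  toFun f := f z * (z.im : ℂ) ^ k
  map_add' f g := by simp [add_mul]
  map_smul' c f := by simp [mul_assoc]

theorem norm_weightedEval_sq (f : CuspForms Γ k) (z : ℍ) :
    ‖weightedEval k z f‖ ^ 2 = invariantNormSq k f z := by
  simp [weightedEval, invariantNormSq, mul_pow, ← pow_mul, mul_comm k, abs_of_pos z.im_pos]

variable [DiscreteTopology Γ] [CompactSpace (quotientSpace Γ)]

theorem volume_fundamentalDomain_lt_top (Γ : Subgroup PSL(2, ℝ)) [DiscreteTopology Γ]
    [CompactSpace (quotientSpace Γ)] : volume (fundamentalDomain Γ) < ⊤ := by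
  obtain ⟨K, hK, hcover⟩ := exists_isCompact_forall_exists_smul_mem Γ ℍ
  exact (measure_fundamentalDomain_le (isFundamentalDomain Γ ‹_›) hcover).trans_lt
    hK.measure_lt_top

theorem integrableOn_petersson (f g : CuspForms Γ k) :
    IntegrableOn (petersson (2 * k : ℤ) f g) (fundamentalDomain Γ) := by
  obtain ⟨K, hK, hcover⟩ := exists_isCompact_forall_exists_smul_mem Γ ℍ
  obtain ⟨M, hM⟩ := hK.exists_bound_of_continuousOn (continuous_petersson f g).continuousOn
  refine Measure.integrableOn_of_bounded (volume_fundamentalDomain_lt_top Γ).ne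
    (continuous_petersson f g).aestronglyMeasurable (M := M) (ae_of_all _ fun z => ?_)
  obtain ⟨γ, hγ⟩ := hcover z
  exact petersson_smul f g γ z ▸ hM _ hγ

theorem integrableOn_invariantNormSq (f : CuspForms Γ k) :
    IntegrableOn (invariantNormSq k f) (fundamentalDomain Γ) :=
  (integrableOn_petersson f f).norm.congr (ae_of_all _ fun z => norm_petersson_self f z)

theorem eq_zero_of_peterssonInner_self_eq_zero {f : CuspForms Γ k}
    (hf : peterssonInner Γ k f f = 0) : f = 0 := by
  rw [peterssonInner_self, Complex.ofReal_eq_zero,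
    integral_eq_zero_iff_of_nonneg (invariantNormSq_nonneg k f) (integrableOn_invariantNormSq f)]
    at hf
  set support : Set ℍ := {z | invariantNormSq k f z ≠ 0}
  have hmeas : MeasurableSet support :=
    (isOpen_ne_fun (continuous_invariantNormSq f) continuous_const).measurableSet
  have hinv (γ : Γ) : γ • support = support := by
    ext z
    simp only [support, Set.mem_smul_set_iff_inv_smul_mem, Set.mem_ofPred_eq, invariantNormSq_smul]
  have hnull : volume support = 0 :=
    (isFundamentalDomain Γ ‹_›).measure_zero_of_invariant _ hinv
      (by rw [← Measure.restrict_apply hmeas]; exact ae_iff.mp hf)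
  have hzero : invariantNormSq k f = fun _ => 0 :=
    ((continuous_invariantNormSq f).ae_eq_iff_eq volume continuous_const).mp (ae_iff.mpr hnull)
  ext z
  simpa [invariantNormSq, z.im_ne_zero] using congrFun hzero z

/-- The Petersson inner product on the cusp forms for a cocompact group. The arguments are swapped
because inner products in the library are conjugate-linear in the first variable. -/
noncomputable abbrev peterssonCore (Γ : Subgroup PSL(2, ℝ)) (k : ℕ) [DiscreteTopology Γ]
    [CompactSpace (quotientSpace Γ)] : InnerProductSpace.Core ℂ (CuspForms Γ k) where
  inner f g := peterssonInner Γ k g f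
  conj_inner_symm f g := by
    simp only [peterssonInner_eq_setIntegral_petersson]
    rw [← integral_conj]
    simp only [← petersson_symm]
  re_inner_nonneg f := by
    rw [peterssonInner_self]
    exact integral_nonneg (invariantNormSq_nonneg k f)
  add_left f g h := by
    simp only [peterssonInner_eq_setIntegral_petersson]
    rw [← integral_add (integrableOn_petersson f h) (integrableOn_petersson g h)]
    simp [petersson, add_mul]
  smul_left f g r := by
    simp only [peterssonInner_eq_setIntegral_petersson]
    rw [← integral_const_mul]
    simp [petersson, mul_assoc]
  definite f := eq_zero_of_peterssonInner_self_eq_zero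

noncomputable instance : NormedAddCommGroup (CuspForms Γ k) :=
  (peterssonCore Γ k).toNormedAddCommGroup

noncomputable instance : InnerProductSpace ℂ (CuspForms Γ k) :=
  InnerProductSpace.ofCore (peterssonCore Γ k).toCore

theorem inner_eq_peterssonInner (f g : CuspForms Γ k) : inner ℂ f g = peterssonInner Γ k g f :=
  rfl

theorem setIntegral_invariantNormSq (f : CuspForms Γ k) :
    ∫ z in fundamentalDomain Γ, invariantNormSq k f z = ‖f‖ ^ 2 := by
  rw [← Complex.ofReal_inj, ← peterssonInner_self, ← inner_eq_peterssonInner,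
    inner_self_eq_norm_sq_to_K]
  norm_cast

theorem isOrthonormalBasis_iff_orthonormal
    (b : Module.Basis (Fin (Module.finrank ℂ (CuspForms Γ k))) ℂ (CuspForms Γ k)) :
    IsOrthonormalBasis Γ k b ↔ Orthonormal ℂ b := by
  rw [orthonormal_iff_ite, IsOrthonormalBasis, forall_comm]
  simp only [inner_eq_peterssonInner, eq_comm]

theorem invariantNormSq_le_mul_norm_sq (hk : 0 < k) {N : ℕ}
    (hN : ∀ w z : ℍ, {γ : Γ | γ • w ∈ Metric.closedBall z 1}.encard ≤ N)
    (f : CuspForms Γ k) (z : ℍ) : invariantNormSq k f z ≤ 9 * N * k * ‖f‖ ^ 2 := by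
  have hlocal := ofReal_invariantNormSq_le_lintegral_closedBall hk
    (UpperHalfPlane.mdifferentiable_iff.mp (ModularFormClass.holo f)) z
  have hfold := setLIntegral_le_mul_setLIntegral_fundamentalDomain (isFundamentalDomain Γ ‹_›)
    Metric.isClosed_closedBall.measurableSet (hN · z)
    (continuous_invariantNormSq f).measurable.ennreal_ofReal
    fun γ w => by rw [invariantNormSq_smul]
  rw [← ofReal_integral_eq_lintegral_ofReal (integrableOn_invariantNormSq f)
    (ae_of_all _ (invariantNormSq_nonneg k f)), setIntegral_invariantNormSq] at hfold
  rw [← ENNReal.ofReal_le_ofReal_iff (by positivity)]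
  calc ENNReal.ofReal (invariantNormSq k f z)
      ≤ ENNReal.ofReal (9 * k) * (N * ENNReal.ofReal (‖f‖ ^ 2)) := hlocal.trans (by gcongr)
    _ = ENNReal.ofReal (9 * N * k * ‖f‖ ^ 2) := by
        rw [← ENNReal.ofReal_natCast N, ← ENNReal.ofReal_mul (by positivity),
          ← ENNReal.ofReal_mul (by positivity)]
        ring_nf

theorem norm_weightedEval_sq_le (hk : 0 < k) {N : ℕ}
    (hN : ∀ w z : ℍ, {γ : Γ | γ • w ∈ Metric.closedBall z 1}.encard ≤ N)
    (z : ℍ) (f : CuspForms Γ k) : ‖weightedEval k z f‖ ^ 2 ≤ 9 * N * k * ‖f‖ ^ 2 :=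
  norm_weightedEval_sq f z ▸ invariantNormSq_le_mul_norm_sq hk hN f z

theorem finite_cuspForms (hk : 0 < k) {N : ℕ}
    (hN : ∀ w z : ℍ, {γ : Γ | γ • w ∈ Metric.closedBall z 1}.encard ≤ N) :
    Module.Finite ℂ (CuspForms Γ k) := by
  have : IsFiniteMeasure (volume.restrict (fundamentalDomain Γ)) :=
    isFiniteMeasure_restrict.mpr (volume_fundamentalDomain_lt_top Γ).ne
  refine finite_of_integral_norm_sq_eq (μ := volume.restrict (fundamentalDomain Γ))
    (by positivity) (fun f => ?_) (norm_weightedEval_sq_le hk hN)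
  simp only [norm_weightedEval_sq, setIntegral_invariantNormSq]

theorem exists_isOrthonormalBasis [Module.Finite ℂ (CuspForms Γ k)] :
    ∃ b, IsOrthonormalBasis Γ k b :=
  ⟨(stdOrthonormalBasis ℂ (CuspForms Γ k)).toBasis,
    (isOrthonormalBasis_iff_orthonormal _).mpr (by simp)⟩

theorem sumSq_le (hk : 0 < k) {N : ℕ}
    (hN : ∀ w z : ℍ, {γ : Γ | γ • w ∈ Metric.closedBall z 1}.encard ≤ N)
    {b : Module.Basis (Fin (Module.finrank ℂ (CuspForms Γ k))) ℂ (CuspForms Γ k)}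
    (hb : IsOrthonormalBasis Γ k b) (z : ℍ) : sumSq Γ k b z ≤ 9 * N * k := by
  calc sumSq Γ k b z = ∑ j, ‖weightedEval k z (b j)‖ ^ 2 := by
        simp only [sumSq, norm_weightedEval_sq, invariantNormSq]
    _ ≤ 9 * N * k := sum_norm_sq_le_of_orthonormal (by positivity)
        (norm_weightedEval_sq_le hk hN z) ((isOrthonormalBasis_iff_orthonormal b).mp hb)

end Petersson

end Fuchsian

theorem mainTheorem2 (Γ₀ : Subgroup PSL(2, ℝ)) (hF : Fuchsian.IsFuchsian Γ₀)
    (hc : Fuchsian.IsCocompact Γ₀) :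
    ∃ C : ℝ, ∀ Γ : Subgroup PSL(2, ℝ), Γ ≤ Γ₀ → Γ.IsFiniteRelIndex Γ₀ →
      ∀ k : ℕ, 0 < k →
        (∃ b, Fuchsian.IsOrthonormalBasis Γ k b) ∧
        ∀ b, Fuchsian.IsOrthonormalBasis Γ k b →
          ∀ z : ℍ, Fuchsian.sumSq Γ k b z ≤ C * k := by
  have : DiscreteTopology Γ₀ := hF
  have : CompactSpace (Fuchsian.quotientSpace Γ₀) := hc
  have := Fuchsian.properlyDiscontinuous Γ₀
  obtain ⟨N, hN⟩ := Fuchsian.exists_forall_encard_smul_mem_closedBall_le Γ₀ ℍ 1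
  refine ⟨9 * N, fun Γ hΓ _ k hk => ?_⟩
  have : DiscreteTopology Γ := DiscreteTopology.of_subset (t := (Γ : Set PSL(2, ℝ))) hF hΓ
  have : CompactSpace (Fuchsian.quotientSpace Γ) :=
    Fuchsian.compactSpace_orbitRel_quotient_of_isFiniteRelIndex (H₀ := Γ₀)
  have hcount (w z : ℍ) : {γ : Γ | γ • w ∈ Metric.closedBall z 1}.encard ≤ N :=
    (Fuchsian.encard_smul_mem_le_of_le hΓ w _).trans (hN w z)
  have := Fuchsian.finite_cuspForms hk hcount
  exact ⟨Fuchsian.exists_isOrthonormalBasis, fun _ hb => Fuchsian.sumSq_le hk hcount hb⟩
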